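/- **Definitions.** Let $\mathrm{Re}$ and $h$ be indeterminates over $\mathbb{Q}$. Let $\mathcal{R}=\mathbb{Q}(\mathrm{Re})\{u,v,p,f^{(1)},f^{(2)}\}$ be the ring of differential polynomials, that is, of polynomials in all derivatives $\partial_x^m\partial_y^n w$ ($m,n\ge 0$) of the five indeterminates $w\in\{u,v,p,f^{(1)},f^{(2)}\}$, and let $\mathcal{I}\subset\mathcal{R}$ be the differential ideal generated by the left-hand sides of the steady Stokes system $$F^{(1)}=u_x+v_y,\qquad F^{(2)}=p_x-\tfrac{1}{\mathrm{Re}}(u_{xx}+u_{yy})-f^{(1)},\qquad F^{(3)}=p_y-\tfrac{1}{\mathrm{Re}}(v_{xx}+v_{yy})-f^{(2)}.$$ Let $\tilde{\mathcal{R}}$ be the ring of difference polynomials over $\mathbb{Q}(\mathrm{Re},h)$, that is, of polynomials in the grid values $w_{j+a,k+b}$ ($a,b\ge 0$), with the shifts $\sigma_1: w_{j,k}\mapsto w_{j+1,k}$ and $\sigma_2: w_{j,k}\mapsto w_{j,k+1}$, which fix the coefficients. Consider the difference polynomials $$\tilde F^{(1)}=\frac{u_{j+2,k+1}-u_{j,k+1}}{2h}+\frac{v_{j+1,k+2}-v_{j+1,k}}{2h},$$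 $$\tilde F^{(2)}=\frac{p_{j+2,k+1}-p_{j,k+1}}{2h}-\frac{1}{\mathrm{Re}}\Delta_1(u_{j,k})-f^{(1)}_{j+1,k+1},$$ $$\tilde F^{(3)}=\frac{p_{j+1,k+2}-p_{j+1,k}}{2h}-\frac{1}{\mathrm{Re}}\Delta_1(v_{j,k})-f^{(2)}_{j+1,k+1},$$ $$\tilde F^{(4)}=\Delta_2(p_{j,k})-\frac{f^{(1)}_{j+3,k+2}-f^{(1)}_{j+1,k+2}}{2h}-\frac{f^{(2)}_{j+2,k+3}-f^{(2)}_{j+2,k+1}}{2h}$$ (the last one is a discrete pressure Poisson equation), where $$\Delta_1(g_{j,k})=\frac{g_{j+2,k+1}+g_{j+1,k+2}-4g_{j+1,k+1}+g_{j+1,k}+g_{j,k+1}}{h^2},$$ $$\Delta_2(g_{j,k})=\frac{g_{j+4,k+2}+g_{j+2,k+4}-4g_{j+2,k+2}+g_{j+2,k}+g_{j,k+2}}{4h^2}.$$ An ideal $J\subset\tilde{\mathcal{R}}$ is a *perfect difference ideal* if it is closed under $\sigma_1,\sigma_2$ and if, for all $g\in\tilde{\mathcal R}$, all monomials $\tau_1,\dots,\tau_r$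 in $\sigma_1,\sigma_2$ and all $k_1,\dots,k_r\ge 0$, $\tau_1(g)^{k_1}\cdots\tau_r(g)^{k_r}\in J$ implies $g\in J$. Let $\llbracket\tilde F\rrbracket$ be the smallest perfect difference ideal containing $\tilde F^{(1)},\dots,\tilde F^{(4)}$. The *Taylor expansion* of $\tilde f\in\tilde{\mathcal R}$ about the grid point $(j+c_1,k+c_2)$, $c_1,c_2\in\mathbb{Z}$, is the Laurent series in $h$ with coefficients in $\mathcal{R}$ obtained by substituting $$w_{j+a,k+b}=\sum_{r,s\ge 0}\frac{(a-c_1)^r(b-c_2)^s}{r!\,s!}\,h^{r+s}\,\partial_x^r\partial_y^s w$$ and expanding the coefficients of $\tilde f$ at $h=0$. For $\tilde f\in\tilde{\mathcal R}$ and $f\in\mathcal R$ write $\tilde f\rhd f$ if there is $k\in\mathbb{Z}$ such that the Taylor expansion of $\tilde f$ about every grid point equals $f\,h^k+O(h^{k+1})$, where $f=0$ is allowed only if the expansion vanishes identically. **Theorem.** The difference scheme $\{\tilde F^{(1)},\tilde F^{(2)},\tilde F^{(3)},\tilde F^{(4)}\}$ is strongly consistent with the Stokes system $\{F^{(1)},F^{(2)},F^{(3)}\}$: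 $$\forall \tilde f\in\llbracket\tilde F\rrbracket\quad \exists f\in\mathcal I\quad \tilde f\rhd f .$$ -/

import Mathlib

namespace StokesFD

noncomputable section

/-- The unknowns of the Stokes system: velocities `u`, `v`, pressure `p`, forces `f₁`, `f₂`.
They serve both as differential and as difference indeterminates. -/
inductive Unknown : Type
  | u | v | p | f₁ | f₂

/-! ### Differential polynomials -/

/-- The ring `K{u, v, p, f₁, f₂}` of differential polynomials in two independent variables `x`, `y`
over a field `K` of constants. The variable `(w, m, n)` is the derivative `∂_x^m ∂_y^n w`. -/
abbrev DiffPoly (K : Type) [Field K] : Type := MvPolynomial (Unknown × ℕ × ℕ) K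

section Differential

variable {K : Type} [Field K]

/-- The unknown `w` as a differential polynomial. -/
def unk (w : Unknown) : DiffPoly K := MvPolynomial.X (w, 0, 0)

/-- The derivation `∂_x`; it annihilates `K`. -/
def dx : Derivation K (DiffPoly K) (DiffPoly K) :=
  MvPolynomial.mkDerivation K fun s => MvPolynomial.X (s.1, s.2.1 + 1, s.2.2)

/-- The derivation `∂_y`; it annihilates `K`. -/
def dy : Derivation K (DiffPoly K) (DiffPoly K) :=
  MvPolynomial.mkDerivation K fun s => MvPolynomial.X (s.1, s.2.1, s.2.2 + 1)

/-- An ideal of differential polynomials closed under both derivations. -/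
structure IsDifferentialIdeal (I : Ideal (DiffPoly K)) : Prop where
  dx_mem : ∀ f ∈ I, dx f ∈ I
  dy_mem : ∀ f ∈ I, dy f ∈ I

/-- The differential ideal generated by `S`: the smallest differential ideal containing `S`. -/
def differentialIdeal (S : Set (DiffPoly K)) : Ideal (DiffPoly K) :=
  sInf {I | IsDifferentialIdeal I ∧ S ⊆ (I : Set (DiffPoly K))}

/-- The Laplace operator. -/
def laplace (f : DiffPoly K) : DiffPoly K := dx (dx f) + dy (dy f)

/-- The continuity equation `u_x + v_y`. -/
def stokes₁ : DiffPoly K := dx (unk .u) + dy (unk .v)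

/-- The first momentum equation `p_x - (1/Re) Δu - f₁`. -/
def stokes₂ (Re : K) : DiffPoly K :=
  dx (unk .p) - MvPolynomial.C (1 / Re) * laplace (unk .u) - unk .f₁

/-- The second momentum equation `p_y - (1/Re) Δv - f₂`. -/
def stokes₃ (Re : K) : DiffPoly K :=
  dy (unk .p) - MvPolynomial.C (1 / Re) * laplace (unk .v) - unk .f₂

/-- The left-hand sides of the steady two-dimensional Stokes system. -/
def stokesSystem (Re : K) : Set (DiffPoly K) := {stokes₁, stokes₂ Re, stokes₃ Re}

end Differential

/-! ### Difference polynomials -/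

/-- The ring of difference polynomials in `u, v, p, f₁, f₂` over the field `K(h)`, where `h` is the
grid spacing. The variable `(w, a, b)` is the grid value `w_{j+a, k+b}`. -/
abbrev GridPoly (K : Type) [Field K] : Type := MvPolynomial (Unknown × ℕ × ℕ) (RatFunc K)

section Difference

variable {K : Type} [Field K]

/-- The grid value `w_{j+a, k+b}`. -/
def grid (w : Unknown) (a b : ℕ) : GridPoly K := MvPolynomial.X (w, a, b)

/-- The translation `σ₁^{τ.1} σ₂^{τ.2}`, sending `w_{j+a, k+b}` to `w_{j+a+τ.1, k+b+τ.2}`;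
it fixes the coefficients. -/
def shift (τ : ℕ × ℕ) : GridPoly K →ₐ[RatFunc K] GridPoly K :=
  MvPolynomial.rename fun s => (s.1, s.2.1 + τ.1, s.2.2 + τ.2)

/-- A perfect difference ideal: an ideal closed under translations which contains `g` as soon as it
contains some product of powers `τ₁(g)^{k₁} ⋯ τᵣ(g)^{kᵣ}` of translates of `g`. -/
structure IsPerfectDifferenceIdeal (J : Ideal (GridPoly K)) : Prop where
  shift_mem : ∀ (τ : ℕ × ℕ), ∀ g ∈ J, shift τ g ∈ J
  perfect : ∀ (g : GridPoly K) (e : ℕ × ℕ →₀ ℕ), (e.prod fun τ k => shift τ g ^ k) ∈ J → g ∈ J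

/-- The perfect difference ideal generated by `S`: the smallest one containing `S`. -/
def perfectDifferenceIdeal (S : Set (GridPoly K)) : Ideal (GridPoly K) :=
  sInf {J | IsPerfectDifferenceIdeal J ∧ S ⊆ (J : Set (GridPoly K))}

/-- The grid spacing `h` as an element of `K(h)`. -/
def spacing : RatFunc K := RatFunc.X

/-- The five-point discrete Laplacian `Δ₁` on the `3 × 3` stencil, applied to `w_{j,k}`. -/
def laplace₁ (w : Unknown) : GridPoly K :=
  MvPolynomial.C (1 / spacing ^ 2) *
    (grid w 2 1 + grid w 1 2 - 4 * grid w 1 1 + grid w 1 0 + grid w 0 1)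

/-- The five-point discrete Laplacian `Δ₂` on the `5 × 5` stencil, applied to `w_{j,k}`. -/
def laplace₂ (w : Unknown) : GridPoly K :=
  MvPolynomial.C (1 / (4 * spacing ^ 2)) *
    (grid w 4 2 + grid w 2 4 - 4 * grid w 2 2 + grid w 2 0 + grid w 0 2)

/-- The discrete continuity equation. -/
def scheme₁ : GridPoly K :=
  MvPolynomial.C (1 / (2 * spacing)) * (grid .u 2 1 - grid .u 0 1) +
    MvPolynomial.C (1 / (2 * spacing)) * (grid .v 1 2 - grid .v 1 0)

/-- The first discrete momentum equation. -/
def scheme₂ (Re : K) : GridPoly K :=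
  MvPolynomial.C (1 / (2 * spacing)) * (grid .p 2 1 - grid .p 0 1) -
    MvPolynomial.C (1 / RatFunc.C Re) * laplace₁ .u - grid .f₁ 1 1

/-- The second discrete momentum equation. -/
def scheme₃ (Re : K) : GridPoly K :=
  MvPolynomial.C (1 / (2 * spacing)) * (grid .p 1 2 - grid .p 1 0) -
    MvPolynomial.C (1 / RatFunc.C Re) * laplace₁ .v - grid .f₂ 1 1

/-- The discrete pressure Poisson equation. -/
def scheme₄ : GridPoly K :=
  laplace₂ .p - MvPolynomial.C (1 / (2 * spacing)) * (grid .f₁ 3 2 - grid .f₁ 1 2) -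
    MvPolynomial.C (1 / (2 * spacing)) * (grid .f₂ 2 3 - grid .f₂ 2 1)

/-- The symmetric finite difference scheme for the Stokes system. -/
def scheme (Re : K) : Set (GridPoly K) := {scheme₁, scheme₂ Re, scheme₃ Re, scheme₄}

end Difference

/-! ### Taylor expansion and consistency -/

section Taylor

open scoped RatFunc

/-- Coefficientwise application of a ring homomorphism to Laurent series. -/
def laurentMap {A B : Type} [CommRing A] [CommRing B] (φ : A →+* B) :
    LaurentSeries A →+* LaurentSeries B where
  toFun s := HahnSeries.map s φ
  map_zero' := by ext; simp
  map_one' := HahnSeries.map_one φ.toMonoidWithZeroHom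
  map_add' x y := by ext; simp
  map_mul' x y := HahnSeries.map_mul φ.toNonUnitalRingHom

variable {K : Type} [Field K]

/-- A coefficient `c ∈ K(h)`, expanded as a Laurent series in `h` at `h = 0`. -/
def coeffExpansion : RatFunc K →+* LaurentSeries (DiffPoly K) :=
  (laurentMap MvPolynomial.C).comp (algebraMap (RatFunc K) (LaurentSeries K))

/-- The formal Taylor series, in powers of `h`, of the grid value `w_{j+a, k+b}` about the grid
point `(j + c.1, k + c.2)`: its coefficient at `h ^ n` is
`∑_{r+s=n} (a - c.1)^r (b - c.2)^s / (r! s!) ∂_x^r ∂_y^s w`. -/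
def gridExpansion (c : ℤ × ℤ) (t : Unknown × ℕ × ℕ) : PowerSeries (DiffPoly K) :=
  PowerSeries.mk fun n => ∑ rs ∈ Finset.HasAntidiagonal.antidiagonal n,
    MvPolynomial.C (((t.2.1 : K) - (c.1 : K)) ^ rs.1 * ((t.2.2 : K) - (c.2 : K)) ^ rs.2 /
      ((rs.1.factorial : K) * (rs.2.factorial : K))) * MvPolynomial.X (t.1, rs.1, rs.2)

/-- The Taylor expansion of a difference polynomial about the grid point `(j + c.1, k + c.2)`, as a
Laurent series in `h` whose coefficients are differential polynomials. -/
def taylor (c : ℤ × ℤ) : GridPoly K →+* LaurentSeries (DiffPoly K) :=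
  MvPolynomial.eval₂Hom coeffExpansion fun t => HahnSeries.ofPowerSeries ℤ _ (gridExpansion c t)

/-- The difference equation `g = 0` implies the differential equation `f = 0`: for some integer `k`
the Taylor expansion of `g` about every grid point is `f h ^ k + O(h ^ (k + 1))`. Here `f` is really
the leading coefficient: it may vanish only when the expansion of `g` vanishes identically
(otherwise every `g` would imply `0 = 0`, by taking `k` too small). -/
def Implies (g : GridPoly K) (f : DiffPoly K) : Prop :=
  ∃ k : ℤ, ∀ c : ℤ × ℤ,
    (∀ m < k, (taylor c g).coeff m = 0) ∧ (taylor c g).coeff k = f ∧ (f = 0 → taylor c g = 0)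

/-- Strong consistency of a set `S` of difference polynomials with a set `F` of differential
polynomials. -/
def IsStronglyConsistent (S : Set (GridPoly K)) (F : Set (DiffPoly K)) : Prop :=
  ∀ g ∈ perfectDifferenceIdeal S, ∃ f ∈ differentialIdeal F, Implies g f

end Taylor

end

end StokesFD

namespace StokesFD

noncomputable section

open Finset hiding antidiagonal mem_antidiagonal
open Finset.HasAntidiagonal (antidiagonal mem_antidiagonal)
open AddMonoidAlgebra (single)
open scoped Matrix

/-! The scheme has an explicit family of solutions, given by a discrete stream function ψ and the
pressure p. Let `sx`, `sy`, `l` be the power series in h, with constant coefficient differential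
operators as coefficients, that represent the central differences and the five-point Laplacian. Put
u = sy ψ, v = -sx ψ, and let f₁, f₂ be whatever the momentum equations then dictate
(`streamMatrix`). Everything commutes, and the wide Laplacian in the pressure equation is sx² + sy²,
so all four difference equations hold identically (`scheme_subset_ker_deformedTaylor`).

Taylor expansion followed by this substitution is a homomorphism from difference polynomials to
Laurent series over a domain. A shift only moves the expansion point, which does not affect
vanishing, so the kernel is a perfect difference ideal
(`isPerfectDifferenceIdeal_ker_deformedTaylor`) and contains the one generated by the scheme.

Let g be in this kernel and let f be the leading coefficient of its Taylor expansion. The leading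
coefficient does not depend on the expansion point (`implies_leadingCoeff`). The lowest term of the
substituted expansion shows that f is annihilated by the limit h = 0 of the substitution, namely u =
ψ_y, v = -ψ_x, f₁ = p_x - Δu/Re, f₂ = p_y - Δv/Re. Sending ψ_y back to u and ψ_x to -v inverts this
limit modulo the Stokes ideal, so f lies in that ideal
(`mem_differentialIdeal_of_constantCoeff_deform`). -/

/-! ### Extending a deformation of a ring to series -/

section Extension

variable {A B : Type} [CommRing A] [CommRing B]

/-- The extension of `θ : A → B⟦h⟧` to power series in `h`: `∑ aₙ hⁿ ↦ ∑ θ(aₙ) hⁿ`. -/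
def powerSeriesExtension (θ : A →+* PowerSeries B) : PowerSeries A →+* PowerSeries B where
  toFun s := PowerSeries.mk fun n =>
    ∑ ij ∈ antidiagonal n, PowerSeries.coeff ij.2 (θ (PowerSeries.coeff ij.1 s))
  map_zero' := by ext; simp
  map_one' := by
    ext n
    rw [PowerSeries.coeff_mk, sum_eq_single (0, n)]
    · simp
    · rintro ⟨i, j⟩ hij hne
      have hi : i ≠ 0 := by
        rintro rfl
        simp_all
      simp [PowerSeries.coeff_one, hi]
    · simp
  map_add' s t := by ext; simp [sum_add_distrib]
  map_mul' s t := by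
    ext n
    simp only [PowerSeries.coeff_mk, PowerSeries.coeff_mul, map_sum, map_mul, sum_mul_sum,
      sum_sigma']
    -- Both sides are sums over (a, b), (c, d) with total n; exchanging b and c is an involution
    -- that matches them.
    refine sum_nbij'
      (fun x => ⟨(x.2.1.1 + x.2.2.1, x.2.1.2 + x.2.2.2), (x.2.1.1, x.2.2.1), x.2.1.2, x.2.2.2⟩)
      (fun x => ⟨(x.2.1.1 + x.2.2.1, x.2.1.2 + x.2.2.2), (x.2.1.1, x.2.2.1), x.2.1.2, x.2.2.2⟩)
      ?_ ?_ ?_ ?_ ?_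
    · rintro ⟨⟨i, j⟩, ⟨a, b⟩, ⟨c, d⟩⟩ h
      simp only [mem_sigma, mem_antidiagonal, and_true] at h ⊢
      omega
    · rintro ⟨⟨i, j⟩, ⟨a, b⟩, ⟨c, d⟩⟩ h
      simp only [mem_sigma, mem_antidiagonal, and_true] at h ⊢
      omega
    · rintro ⟨⟨i, j⟩, ⟨a, b⟩, ⟨c, d⟩⟩ h
      simp only [mem_sigma, mem_antidiagonal] at h
      obtain ⟨-, rfl, rfl⟩ := h
      rfl
    · rintro ⟨⟨i, j⟩, ⟨a, b⟩, ⟨c, d⟩⟩ h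
      simp only [mem_sigma, mem_antidiagonal] at h
      obtain ⟨-, rfl, rfl⟩ := h
      rfl
    · rintro ⟨⟨i, j⟩, ⟨a, b⟩, ⟨c, d⟩⟩ h
      rfl

variable (θ : A →+* PowerSeries B)

theorem coeff_powerSeriesExtension (s : PowerSeries A) (n : ℕ) :
    PowerSeries.coeff n (powerSeriesExtension θ s) =
      ∑ ij ∈ antidiagonal n, PowerSeries.coeff ij.2 (θ (PowerSeries.coeff ij.1 s)) :=
  PowerSeries.coeff_mk n fun n =>
    ∑ ij ∈ antidiagonal n, PowerSeries.coeff ij.2 (θ (PowerSeries.coeff ij.1 s))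

theorem powerSeriesExtension_C (a : A) : powerSeriesExtension θ (PowerSeries.C a) = θ a := by
  ext n
  rw [coeff_powerSeriesExtension, sum_eq_single (0, n)]
  · simp
  · rintro ⟨i, j⟩ hij hne
    have hi : i ≠ 0 := by
      rintro rfl
      simp_all
    simp [PowerSeries.coeff_C, hi]
  · simp

theorem powerSeriesExtension_X : powerSeriesExtension θ PowerSeries.X = PowerSeries.X := by
  ext n
  rw [coeff_powerSeriesExtension]
  rcases n with _ | n
  · simp
  · rw [sum_eq_single (1, n)]
    · simp [PowerSeries.coeff_X, PowerSeries.coeff_one]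
    · rintro ⟨i, j⟩ hij hne
      have hi : i ≠ 1 := by
        rintro rfl
        simp only [mem_antidiagonal] at hij
        exact hne (Prod.ext rfl (by simp; omega))
      simp [PowerSeries.coeff_X, hi]
    · intro h
      simp [add_comm] at h

theorem isUnit_ofPowerSeries_X :
    IsUnit (HahnSeries.ofPowerSeries ℤ B PowerSeries.X) := by
  have := @LaurentSeries.of_powerSeries_localization B _
  exact IsLocalization.map_units (M := Submonoid.powers (PowerSeries.X : PowerSeries B))
    (LaurentSeries B) ⟨PowerSeries.X, Submonoid.mem_powers _⟩

/-- The extension of `θ : A → B⟦h⟧` to Laurent series in `h`, fixing `h`. -/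
def laurentExtension : LaurentSeries A →+* LaurentSeries B :=
  haveI : IsLocalization.Away (PowerSeries.X : PowerSeries A) (LaurentSeries A) :=
    LaurentSeries.of_powerSeries_localization
  IsLocalization.Away.lift (PowerSeries.X : PowerSeries A)
    (g := (HahnSeries.ofPowerSeries ℤ B).comp (powerSeriesExtension θ)) (by
      rw [RingHom.comp_apply, powerSeriesExtension_X]
      exact isUnit_ofPowerSeries_X)

theorem laurentExtension_ofPowerSeries (s : PowerSeries A) :
    laurentExtension θ (HahnSeries.ofPowerSeries ℤ A s) =
      HahnSeries.ofPowerSeries ℤ B (powerSeriesExtension θ s) :=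
  haveI : IsLocalization.Away (PowerSeries.X : PowerSeries A) (LaurentSeries A) :=
    LaurentSeries.of_powerSeries_localization
  IsLocalization.Away.lift_eq (PowerSeries.X : PowerSeries A) _ s

theorem laurentExtension_single_one (k : ℤ) :
    laurentExtension θ (HahnSeries.single k 1) = HahnSeries.single k 1 := by
  have hnat (n : ℕ) : laurentExtension θ (HahnSeries.single (n : ℤ) 1) =
      HahnSeries.single (n : ℤ) 1 := by
    rw [← HahnSeries.ofPowerSeries_X_pow, laurentExtension_ofPowerSeries, map_pow,
      powerSeriesExtension_X, HahnSeries.ofPowerSeries_X_pow]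
  obtain ⟨n, rfl | rfl⟩ := k.eq_nat_or_neg
  · exact hnat n
  -- The image of h⁻ⁿ is an inverse of hⁿ, and inverses are unique.
  · have h (C : Type) [CommRing C] : (HahnSeries.single (-(n : ℤ)) 1 : LaurentSeries C) *
        HahnSeries.single (n : ℤ) 1 = 1 := by
      rw [HahnSeries.single_mul_single]
      simp
    have h' := congrArg (laurentExtension θ) (h A)
    rw [map_mul, hnat, RingHom.map_one] at h'
    calc _ = laurentExtension θ (HahnSeries.single (-(n : ℤ)) 1) *
          (HahnSeries.single (-(n : ℤ)) 1 * HahnSeries.single (n : ℤ) 1) := by rw [h, mul_one]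
      _ = HahnSeries.single (-(n : ℤ)) 1 * (laurentExtension θ (HahnSeries.single (-(n : ℤ)) 1) *
          HahnSeries.single (n : ℤ) 1) := by ring
      _ = _ := by rw [h', mul_one]

theorem laurentExtension_eq_single_mul (s : LaurentSeries A) :
    laurentExtension θ s = HahnSeries.single s.order 1 *
      HahnSeries.ofPowerSeries ℤ B (powerSeriesExtension θ s.powerSeriesPart) := by
  conv_lhs => rw [← LaurentSeries.single_order_mul_powerSeriesPart s]
  rw [map_mul, laurentExtension_single_one, laurentExtension_ofPowerSeries]

theorem coeff_laurentExtension_of_lt (s : LaurentSeries A) {m : ℤ} (hm : m < s.order) :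
    (laurentExtension θ s).coeff m = 0 := by
  rw [laurentExtension_eq_single_mul, show m = (m - s.order) + s.order by ring,
    HahnSeries.coeff_single_mul_add, PowerSeries.coeff_coe, if_pos (by omega), mul_zero]

/-- As θ introduces no negative powers of h, only the h⁰ part of θ reaches the lowest term. For s =
0 the order is 0 by convention and both sides vanish. -/
theorem coeff_laurentExtension_order (s : LaurentSeries A) :
    (laurentExtension θ s).coeff s.order =
      PowerSeries.constantCoeff (θ (s.coeff s.order)) := by
  have h := HahnSeries.coeff_single_mul_add (r := (1 : B))
    (x := HahnSeries.ofPowerSeries ℤ B (powerSeriesExtension θ s.powerSeriesPart))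
    (a := 0) (b := s.order)
  rw [zero_add] at h
  rw [laurentExtension_eq_single_mul, h, PowerSeries.coeff_coe]
  simp [coeff_powerSeriesExtension]

theorem laurentExtension_injective
    (hθ : ∀ a, PowerSeries.constantCoeff (θ a) = 0 → a = 0) :
    Function.Injective (laurentExtension θ) := by
  rw [injective_iff_map_eq_zero]
  intro s hs
  by_contra hne
  have h := coeff_laurentExtension_order θ s
  rw [hs, HahnSeries.coeff_zero] at h
  exact HahnSeries.coeff_order_eq_zero.not.mpr hne (hθ _ h.symm)

end Extension

instance : DecidableEq Unknown := fun a b => by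
  cases a <;> cases b <;> first | exact isTrue rfl | exact isFalse nofun

instance : Fintype Unknown where
  elems := {.u, .v, .p, .f₁, .f₂}
  complete w := by cases w <;> decide

theorem sum_unknown {M : Type} [AddCommMonoid M] (g : Unknown → M) :
    ∑ w, g w = g .u + g .v + g .p + g .f₁ + g .f₂ := by
  simp [Finset.sum, Finset.univ, Fintype.elems, add_assoc]

/-! ### Symbols of differential operators -/

section Symbols

variable {K : Type} [Field K]

/-- Symbols of linear differential operators with constant coefficients; `single (r, s) 1` is the
symbol of `∂_x^r ∂_y^s`. -/
abbrev Symbol (K : Type) [Field K] : Type := AddMonoidAlgebra K (ℕ × ℕ)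

/-- The differential operator with a given symbol, applied to the unknown `w`. -/
def applySymbol (w : Unknown) : Symbol K →ₗ[K] DiffPoly K :=
  (Finsupp.linearCombination K fun rs => (MvPolynomial.X (w, rs) : DiffPoly K)) ∘ₗ
    (AddMonoidAlgebra.coeffLinearEquiv K).toLinearMap

theorem applySymbol_single (w : Unknown) (rs : ℕ × ℕ) (a : K) :
    applySymbol w (single rs a) = MvPolynomial.C a * MvPolynomial.X (w, rs) := by
  simp [applySymbol, MvPolynomial.smul_eq_C_mul]

/-- The sum of the operators with symbols `q w` applied to the unknowns `w`, for operators that are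
power series in `h`. -/
def applySeries : (Unknown → PowerSeries (Symbol K)) →ₗ[K] PowerSeries (DiffPoly K) where
  toFun q := PowerSeries.mk fun n => ∑ w, applySymbol w (PowerSeries.coeff n (q w))
  map_add' q q' := by ext1; simp [sum_add_distrib]
  map_smul' a q := by ext1; simp [smul_sum]

theorem coeff_applySeries (q : Unknown → PowerSeries (Symbol K)) (n : ℕ) :
    PowerSeries.coeff n (applySeries q) = ∑ w, applySymbol w (PowerSeries.coeff n (q w)) :=
  PowerSeries.coeff_mk n fun n => ∑ w, applySymbol w (PowerSeries.coeff n (q w))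

theorem applySeries_X_smul (q : Unknown → PowerSeries (Symbol K)) :
    applySeries ((PowerSeries.X : PowerSeries (Symbol K)) • q) =
      PowerSeries.X * applySeries q := by
  ext1 n
  rcases n with _ | n
  · simp [coeff_applySeries]
  · rw [PowerSeries.coeff_succ_X_mul]
    simp [coeff_applySeries, PowerSeries.coeff_succ_X_mul]

/-- The homomorphism replacing each unknown `w` by the series `∑_{w'} N w w' (w')`, compatibly with
the derivations. -/
def deform (N : Matrix Unknown Unknown (PowerSeries (Symbol K))) :
    DiffPoly K →+* PowerSeries (DiffPoly K) :=
  MvPolynomial.eval₂Hom (PowerSeries.C.comp MvPolynomial.C) fun t =>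
    applySeries ((PowerSeries.C (single t.2 1) : PowerSeries (Symbol K)) • N.row t.1)

variable (N : Matrix Unknown Unknown (PowerSeries (Symbol K)))

theorem deform_C (a : K) :
    deform N (MvPolynomial.C a) = PowerSeries.C (MvPolynomial.C a) := by
  simp [deform]

theorem deform_X (t : Unknown × ℕ × ℕ) : deform N (MvPolynomial.X t) =
    applySeries ((PowerSeries.C (single t.2 1) : PowerSeries (Symbol K)) • N.row t.1) := by
  simp [deform]

theorem deform_applySymbol (w : Unknown) (a : Symbol K) :
    deform N (applySymbol w a) = applySeries ((PowerSeries.C a : PowerSeries (Symbol K)) • N.row w) := by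
  induction a using AddMonoidAlgebra.induction_linear with
  | zero => simp
  | add a b ha hb => rw [map_add, map_add, ha, hb, map_add, add_smul, map_add]
  | single rs a =>
    have h : (PowerSeries.C (single rs a) : PowerSeries (Symbol K)) • N.row w =
        a • (PowerSeries.C (single rs 1) : PowerSeries (Symbol K)) • N.row w := by
      rw [← smul_assoc, ← mul_one a, ← smul_eq_mul, ← AddMonoidAlgebra.smul_single]
      congr 1
      ext1 n
      rcases n with _ | n <;> simp [PowerSeries.coeff_C]
    rw [h, map_smul, ← deform_X N (w, rs), applySymbol_single, map_mul, deform_C]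
    ext1 n
    simp [MvPolynomial.smul_eq_C_mul]

/-- Substituting linear expressions into linear ones is a vector-matrix product. This reduces the
later checks to identities in the commutative ring of power series with symbol coefficients. -/
theorem powerSeriesExtension_applySeries (q : Unknown → PowerSeries (Symbol K)) :
    powerSeriesExtension (deform N) (applySeries q) = applySeries (q ᵥ* N) := by
  ext1 n
  simp only [coeff_powerSeriesExtension, coeff_applySeries, map_sum, deform_applySymbol,
    Matrix.vecMul, dotProduct, PowerSeries.coeff_mul, Pi.smul_apply, smul_eq_mul, Matrix.row_apply]
  refine (sum_congr rfl fun _ _ => sum_comm).trans (sum_comm.trans ?_)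
  refine sum_congr rfl fun w' _ => sum_comm.trans ?_
  refine sum_congr rfl fun w _ => sum_congr rfl fun ij _ => ?_
  rw [← map_sum, ← PowerSeries.coeff_mul, PowerSeries.coeff_C_mul]

end Symbols

/-! ### Translations as exponentials of derivations -/

section Translation

variable {K : Type} [Field K] [CharZero K]

/-- The symbol `exp (h (α ∂_x + β ∂_y))` of the translation by `(α h, β h)`. -/
def translation (α β : K) : PowerSeries (Symbol K) :=
  PowerSeries.rescale (single (1, 0) α + single (0, 1) β) (PowerSeries.exp (Symbol K))

theorem translation_mul (α β α' β' : K) :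
    translation α β * translation α' β' = translation (α + α') (β + β') := by
  rw [translation, translation, PowerSeries.exp_mul_exp_eq_exp_add, translation,
    AddMonoidAlgebra.single_add, AddMonoidAlgebra.single_add]
  congr 2
  abel

theorem coeff_translation (α β : K) (n : ℕ) :
    PowerSeries.coeff n (translation α β) = ∑ rs ∈ antidiagonal n,
      single rs (α ^ rs.1 * β ^ rs.2 / ((rs.1.factorial : K) * (rs.2.factorial : K))) := by
  rw [translation, PowerSeries.coeff_rescale, PowerSeries.coeff_exp,
    (Commute.all _ _).add_pow', sum_mul]
  refine sum_congr rfl fun rs hrs => ?_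
  obtain ⟨r, s⟩ := rs
  rw [mem_antidiagonal] at hrs
  subst hrs
  have h : algebraMap ℚ (Symbol K) (1 / ((r + s).factorial : ℚ)) =
      single 0 (1 / ((r + s).factorial : K)) := by
    rw [IsScalarTower.algebraMap_apply ℚ K (Symbol K)]
    simp
  simp only [h, AddMonoidAlgebra.single_pow, AddMonoidAlgebra.single_mul_single,
    AddMonoidAlgebra.smul_single, smul_mul_assoc, Prod.smul_mk, Prod.mk_add_mk]
  have hr := Nat.cast_ne_zero (R := K).mpr r.factorial_ne_zero
  have hs := Nat.cast_ne_zero (R := K).mpr s.factorial_ne_zero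
  have hrs := Nat.cast_ne_zero (R := K).mpr (r + s).factorial_ne_zero
  have hc : ((r + s).choose r : K) * r.factorial * s.factorial = (r + s).factorial := by
    rw [Nat.choose_symm_add]
    exact_mod_cast Nat.add_choose_mul_factorial_mul_factorial r s
  congr 1
  · simp
  · rw [nsmul_eq_mul, eq_div_iff (mul_ne_zero hr hs)]
    field_simp
    rw [← hc]
    ring

/-- The double Taylor sum is the binomial expansion of an exponential, so the additivity
`translation_mul` becomes available for grid values. -/
theorem gridExpansion_eq (c : ℤ × ℤ) (t : Unknown × ℕ × ℕ) :
    gridExpansion (K := K) c t =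
      applySeries (Pi.single t.1 (translation (t.2.1 - c.1 : K) (t.2.2 - c.2))) := by
  ext1 n
  rw [coeff_applySeries, sum_eq_single t.1]
  · simp [gridExpansion, coeff_translation, applySymbol_single]
  · intro w _ hw
    simp [hw]
  · simp

end Translation

/-! ### Taylor expansion of coefficients, grid values and shifts -/

section Expansion

variable {K : Type} [Field K] 

theorem coeffExpansion_C (a : K) : coeffExpansion (RatFunc.C a) =
    HahnSeries.ofPowerSeries ℤ (DiffPoly K) (PowerSeries.C (MvPolynomial.C a)) := by
  rw [coeffExpansion, RingHom.comp_apply, ← RatFunc.algebraMap_C,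
    ← IsScalarTower.algebraMap_apply, HahnSeries.ofPowerSeries_C]
  have h : algebraMap (Polynomial K) (LaurentSeries K) (Polynomial.C a) = HahnSeries.C a := by
    simp [← Polynomial.algebraMap_eq]
  rw [h]
  ext1
  ext1 n
  change MvPolynomial.C ((HahnSeries.single 0 a).coeff n) = (HahnSeries.single 0 _).coeff n
  rcases eq_or_ne n 0 with rfl | hn
  · simp
  · simp [hn]

theorem coeffExpansion_X : coeffExpansion (RatFunc.X : RatFunc K) =
    HahnSeries.ofPowerSeries ℤ (DiffPoly K) PowerSeries.X := by
  rw [coeffExpansion, RingHom.comp_apply, RatFunc.coe_X, HahnSeries.ofPowerSeries_X]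
  ext1
  ext1 n
  change MvPolynomial.C ((HahnSeries.single 1 1).coeff n) = (HahnSeries.single 1 1).coeff n
  rcases eq_or_ne n 1 with rfl | hn
  · simp
  · simp [hn]

theorem laurentExtension_deform_coeffExpansion
    (N : Matrix Unknown Unknown (PowerSeries (Symbol K))) (a : RatFunc K) :
    laurentExtension (deform N) (coeffExpansion a) = coeffExpansion a := by
  suffices h : (laurentExtension (deform N)).comp coeffExpansion = coeffExpansion from
    RingHom.congr_fun h a
  -- K(h) is a localization of K[h], so agreement on constants and on h suffices.
  refine IsLocalization.ringHom_ext (nonZeroDivisors (Polynomial K)) (Polynomial.ringHom_ext ?_ ?_)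
  · intro a
    simp only [RingHom.comp_apply, RatFunc.algebraMap_C, coeffExpansion_C,
      laurentExtension_ofPowerSeries, powerSeriesExtension_C, deform_C]
  · simp only [RingHom.comp_apply, RatFunc.algebraMap_X, coeffExpansion_X,
      laurentExtension_ofPowerSeries, powerSeriesExtension_X]

theorem taylor_C (c : ℤ × ℤ) (a : RatFunc K) :
    taylor c (MvPolynomial.C a) = coeffExpansion a := by
  simp [taylor]

theorem taylor_X [CharZero K] (c : ℤ × ℤ) (t : Unknown × ℕ × ℕ) :
    taylor (K := K) c (MvPolynomial.X t) = HahnSeries.ofPowerSeries ℤ (DiffPoly K)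
      (applySeries (Pi.single t.1 (translation (t.2.1 - c.1 : K) (t.2.2 - c.2)))) := by
  simp [taylor, gridExpansion_eq]

theorem taylor_shift (c : ℤ × ℤ) (τ : ℕ × ℕ) (g : GridPoly K) :
    taylor c (shift τ g) = taylor (c - ((τ.1 : ℤ), (τ.2 : ℤ))) g := by
  suffices h : (taylor c).comp (shift τ : GridPoly K →ₐ[RatFunc K] GridPoly K).toRingHom =
      taylor (c - ((τ.1 : ℤ), (τ.2 : ℤ))) from RingHom.congr_fun h g
  refine MvPolynomial.ringHom_ext ?_ ?_
  · intro a
    simp [taylor, shift]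
  · intro t
    simp only [RingHom.comp_apply, AlgHom.toRingHom_eq_coe, RingHom.coe_coe, shift,
      MvPolynomial.rename_X, taylor, MvPolynomial.coe_eval₂Hom, MvPolynomial.eval₂_X]
    congr 1
    ext1 n
    simp only [gridExpansion, PowerSeries.coeff_mk]
    refine sum_congr rfl fun rs _ => ?_
    have h₁ : ((t.2.1 + τ.1 : ℕ) : K) - (c.1 : K) =
        t.2.1 - ((c - ((τ.1 : ℤ), (τ.2 : ℤ))).1 : ℤ) := by
      push_cast [Prod.fst_sub]
      ring
    have h₂ : ((t.2.2 + τ.2 : ℕ) : K) - (c.2 : K) =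
        t.2.2 - ((c - ((τ.1 : ℤ), (τ.2 : ℤ))).2 : ℤ) := by
      push_cast [Prod.snd_sub]
      ring
    rw [h₁, h₂]

end Expansion

/-! ### Independence of the expansion point, and kernels as perfect ideals -/

section Deformation

variable {K : Type} [Field K]

/-- The Taylor expansion about a grid point, followed by a deformation of the unknowns. -/
def deformedTaylor (N : Matrix Unknown Unknown (PowerSeries (Symbol K))) (c : ℤ × ℤ) :
    GridPoly K →+* LaurentSeries (DiffPoly K) :=
  (laurentExtension (deform N)).comp (taylor c)

variable (N : Matrix Unknown Unknown (PowerSeries (Symbol K)))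

theorem deformedTaylor_C (c : ℤ × ℤ) (a : RatFunc K) :
    deformedTaylor N c (MvPolynomial.C a) = coeffExpansion a := by
  rw [deformedTaylor, RingHom.comp_apply, taylor_C, laurentExtension_deform_coeffExpansion]

/-- If the deformed expansion of `g` vanishes, then the undeformed limit annihilates the leading
coefficient of the expansion of `g`. -/
theorem constantCoeff_deform_leadingCoeff {g : GridPoly K} (hg : deformedTaylor N 0 g = 0) :
    PowerSeries.constantCoeff (deform N ((taylor 0 g).coeff (taylor 0 g).order)) = 0 := by
  rw [← coeff_laurentExtension_order]
  exact congrArg (fun s => HahnSeries.coeff s _) hg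

variable [CharZero K]

theorem deformedTaylor_X (c : ℤ × ℤ) (t : Unknown × ℕ × ℕ) :
    deformedTaylor N c (MvPolynomial.X t) = HahnSeries.ofPowerSeries ℤ (DiffPoly K)
      (applySeries (translation (t.2.1 - c.1 : K) (t.2.2 - c.2) • N.row t.1)) := by
  rw [deformedTaylor, RingHom.comp_apply, taylor_X, laurentExtension_ofPowerSeries,
    powerSeriesExtension_applySeries, Matrix.single_vecMul]

/-- Moving the expansion point is itself a deformation: the scalar matrix exp(h(d₁∂_x + d₂∂_y)) acts
on all unknowns. -/
theorem taylor_sub (c d : ℤ × ℤ) (g : GridPoly K) :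
    taylor (c - d) g =
      laurentExtension (deform (translation (d.1 : K) d.2 • 1)) (taylor c g) := by
  suffices h : taylor (c - d) = deformedTaylor (translation (d.1 : K) d.2 • 1) c from
    RingHom.congr_fun h g
  refine MvPolynomial.ringHom_ext ?_ ?_
  · intro a
    rw [taylor_C, deformedTaylor_C]
  · intro t
    rw [taylor_X, deformedTaylor_X]
    congr 2
    ext1 w
    rw [Pi.smul_apply, Matrix.row_apply, Matrix.smul_apply, smul_smul, translation_mul, Matrix.one_apply]
    rcases eq_or_ne t.1 w with rfl | h
    · rw [Pi.single_eq_same, if_pos rfl, smul_eq_mul, mul_one]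
      congr 1 <;> push_cast [Prod.fst_sub, Prod.snd_sub] <;> ring
    · simp [h, h.symm]

theorem deformedTaylor_sub (c d : ℤ × ℤ) (g : GridPoly K) :
    deformedTaylor N (c - d) g =
      laurentExtension (deform (translation (d.1 : K) d.2 • 1)) (deformedTaylor N c g) := by
  suffices h : deformedTaylor N (c - d) =
      (laurentExtension (deform (translation (d.1 : K) d.2 • 1))).comp (deformedTaylor N c) from
    RingHom.congr_fun h g
  refine MvPolynomial.ringHom_ext ?_ ?_
  · intro a
    rw [RingHom.comp_apply, deformedTaylor_C, deformedTaylor_C,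
      laurentExtension_deform_coeffExpansion]
  · intro t
    rw [RingHom.comp_apply, deformedTaylor_X, deformedTaylor_X, laurentExtension_ofPowerSeries,
      powerSeriesExtension_applySeries, Matrix.vecMul_smul, Matrix.vecMul_one, smul_smul,
      translation_mul]
    have h₁ : (t.2.1 : K) - ((c - d).1 : ℤ) = d.1 + (t.2.1 - c.1) := by
      push_cast [Prod.fst_sub]
      ring
    have h₂ : (t.2.2 : K) - ((c - d).2 : ℤ) = d.2 + (t.2.2 - c.2) := by
      push_cast [Prod.snd_sub]
      ring
    rw [h₁, h₂]

/-- A translation by a multiple of h is the identity modulo h. Hence moving the expansion point is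
injective and preserves leading coefficients. -/
theorem constantCoeff_deform_translation (α β : K) (f : DiffPoly K) :
    PowerSeries.constantCoeff (deform (translation α β • 1) f) = f := by
  suffices h : (PowerSeries.constantCoeff (R := DiffPoly K)).comp (deform (translation α β • 1)) =
      RingHom.id _ from RingHom.congr_fun h f
  refine MvPolynomial.ringHom_ext ?_ ?_
  · intro a
    simp [deform_C]
  · intro t
    rw [RingHom.comp_apply, deform_X, ← PowerSeries.coeff_zero_eq_constantCoeff_apply,
      coeff_applySeries, sum_eq_single t.1]
    · simp [applySymbol_single, translation]
    · intro w _ hw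
      simp [hw.symm]
    · simp

theorem laurentExtension_translation_injective (α β : K) :
    Function.Injective (laurentExtension (deform (K := K) (translation α β • 1))) :=
  laurentExtension_injective _ fun f hf => by
    rwa [constantCoeff_deform_translation] at hf

theorem deformedTaylor_eq_zero_iff (c d : ℤ × ℤ) (g : GridPoly K) :
    deformedTaylor N c g = 0 ↔ deformedTaylor N d g = 0 := by
  rw [← sub_sub_cancel d c, deformedTaylor_sub,
    map_eq_zero_iff _ (laurentExtension_translation_injective _ _)]

/-- A shift changes only the expansion point, so g and all its translates vanish together. The
target is a domain, so a vanishing product of powers of translates forces some translate, hence g,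
to vanish. -/
theorem isPerfectDifferenceIdeal_ker_deformedTaylor :
    IsPerfectDifferenceIdeal (RingHom.ker (deformedTaylor N 0)) := by
  have hshift (τ : ℕ × ℕ) (g : GridPoly K) :
      deformedTaylor N 0 (shift τ g) = deformedTaylor N (0 - ((τ.1 : ℤ), (τ.2 : ℤ))) g := by
    rw [deformedTaylor, RingHom.comp_apply, taylor_shift]
    rfl
  refine ⟨fun τ g hg => ?_, fun g e hg => ?_⟩
  · rw [RingHom.mem_ker] at hg ⊢
    rw [hshift]
    exact (deformedTaylor_eq_zero_iff N _ _ g).mp hg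
  · rw [RingHom.mem_ker] at hg ⊢
    rw [Finsupp.prod, map_prod, prod_eq_zero_iff] at hg
    obtain ⟨τ, -, hτ⟩ := hg
    rw [map_pow] at hτ
    have h := eq_zero_of_pow_eq_zero hτ
    rw [hshift] at h
    exact (deformedTaylor_eq_zero_iff N _ _ g).mp h

/-- A difference polynomial implies the leading coefficient of its Taylor expansion. -/
theorem implies_leadingCoeff (g : GridPoly K) :
    Implies g ((taylor 0 g).coeff (taylor 0 g).order) := by
  refine ⟨(taylor 0 g).order, fun c => ?_⟩
  rw [← sub_sub_cancel 0 c, taylor_sub]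
  refine ⟨fun m hm => coeff_laurentExtension_of_lt _ _ hm, ?_, fun h => ?_⟩
  · rw [coeff_laurentExtension_order, constantCoeff_deform_translation]
  -- The coefficient at the order is zero only for the zero series, so f = 0 occurs exactly when the
  -- whole expansion vanishes.
  · rw [HahnSeries.coeff_order_eq_zero.mp h, map_zero]

end Deformation

/-! ### The differential ideal of the Stokes system -/

section StokesIdeal

variable {K : Type} [Field K]

theorem isDifferentialIdeal_differentialIdeal (S : Set (DiffPoly K)) :
    IsDifferentialIdeal (differentialIdeal S) := by
  constructor <;> intro f hf <;> rw [differentialIdeal, Submodule.mem_sInf] at hf ⊢ <;>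
    intro I hI
  · exact hI.1.dx_mem f (hf I hI)
  · exact hI.1.dy_mem f (hf I hI)

theorem subset_differentialIdeal (S : Set (DiffPoly K)) :
    S ⊆ (differentialIdeal S : Set (DiffPoly K)) := by
  intro f hf
  rw [SetLike.mem_coe, differentialIdeal, Submodule.mem_sInf]
  exact fun I hI => hI.2 hf

theorem dx_X (t : Unknown × ℕ × ℕ) :
    dx (MvPolynomial.X t : DiffPoly K) = MvPolynomial.X (t.1, t.2.1 + 1, t.2.2) :=
  MvPolynomial.mkDerivation_X _ _ _

theorem dy_X (t : Unknown × ℕ × ℕ) :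
    dy (MvPolynomial.X t : DiffPoly K) = MvPolynomial.X (t.1, t.2.1, t.2.2 + 1) :=
  MvPolynomial.mkDerivation_X _ _ _

theorem dx_C_mul (a : K) (f : DiffPoly K) :
    dx (MvPolynomial.C a * f) = MvPolynomial.C a * dx f := by
  simp [Derivation.leibniz, MvPolynomial.derivation_C]

theorem dy_C_mul (a : K) (f : DiffPoly K) :
    dy (MvPolynomial.C a * f) = MvPolynomial.C a * dy f := by
  simp [Derivation.leibniz, MvPolynomial.derivation_C]

/-- A family indexed by the orders of derivation lies in a differential ideal if its first member
does. -/
theorem IsDifferentialIdeal.mem_of_family {I : Ideal (DiffPoly K)} (hI : IsDifferentialIdeal I)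
    (F : ℕ → ℕ → DiffPoly K) (h₀ : F 0 0 ∈ I) (hx : ∀ m n, dx (F m n) = F (m + 1) n)
    (hy : ∀ m n, dy (F m n) = F m (n + 1)) (m n : ℕ) : F m n ∈ I := by
  induction n with
  | zero =>
    induction m with
    | zero => exact h₀
    | succ m ih => exact hx m 0 ▸ hI.dx_mem _ ih
  | succ n ih => exact hy m n ▸ hI.dy_mem _ ih

variable (Re : K) (m n : ℕ)

theorem continuity_mem : MvPolynomial.X (.u, m + 1, n) + MvPolynomial.X (.v, m, n + 1) ∈
    differentialIdeal (stokesSystem Re) := by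
  let F : ℕ → ℕ → DiffPoly K := fun m n => MvPolynomial.X (.u, m + 1, n) + MvPolynomial.X (.v, m, n + 1)
  change F m n ∈ _
  refine (isDifferentialIdeal_differentialIdeal _).mem_of_family F ?_ ?_ ?_ m n
  · have h := subset_differentialIdeal (stokesSystem Re)
      (show stokes₁ ∈ stokesSystem Re by simp [stokesSystem])
    simpa only [F, stokes₁, unk, dx_X, dy_X, SetLike.mem_coe] using h
  · intro m n
    simp only [F, map_add, dx_X]
  · intro m n
    simp only [F, map_add, dy_X]

theorem momentum₁_mem : MvPolynomial.X (.p, m + 1, n) - MvPolynomial.C (1 / Re) *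
      (MvPolynomial.X (.u, m + 2, n) + MvPolynomial.X (.u, m, n + 2)) -
      MvPolynomial.X (.f₁, m, n) ∈ differentialIdeal (stokesSystem Re) := by
  let F : ℕ → ℕ → DiffPoly K := fun m n => MvPolynomial.X (.p, m + 1, n) - MvPolynomial.C (1 / Re) *
      (MvPolynomial.X (.u, m + 2, n) + MvPolynomial.X (.u, m, n + 2)) -
      MvPolynomial.X (.f₁, m, n)
  change F m n ∈ _
  refine (isDifferentialIdeal_differentialIdeal _).mem_of_family F ?_ ?_ ?_ m n
  · have h := subset_differentialIdeal (stokesSystem Re)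
      (show stokes₂ Re ∈ stokesSystem Re by simp [stokesSystem])
    simpa only [F, stokes₂, unk, laplace, dx_X, dy_X, SetLike.mem_coe] using h
  · intro m n
    simp only [F, map_add, map_sub, dx_C_mul, dx_X]
  · intro m n
    simp only [F, map_add, map_sub, dy_C_mul, dy_X]

theorem momentum₂_mem : MvPolynomial.X (.p, m, n + 1) - MvPolynomial.C (1 / Re) *
      (MvPolynomial.X (.v, m + 2, n) + MvPolynomial.X (.v, m, n + 2)) -
      MvPolynomial.X (.f₂, m, n) ∈ differentialIdeal (stokesSystem Re) := by
  let F : ℕ → ℕ → DiffPoly K := fun m n => MvPolynomial.X (.p, m, n + 1) - MvPolynomial.C (1 / Re) *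
      (MvPolynomial.X (.v, m + 2, n) + MvPolynomial.X (.v, m, n + 2)) -
      MvPolynomial.X (.f₂, m, n)
  change F m n ∈ _
  refine (isDifferentialIdeal_differentialIdeal _).mem_of_family F ?_ ?_ ?_ m n
  · have h := subset_differentialIdeal (stokesSystem Re)
      (show stokes₃ Re ∈ stokesSystem Re by simp [stokesSystem])
    simpa only [F, stokes₃, unk, laplace, dx_X, dy_X, SetLike.mem_coe] using h
  · intro m n
    simp only [F, map_add, map_sub, dx_C_mul, dx_X]
  · intro m n
    simp only [F, map_add, map_sub, dy_C_mul, dy_X]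

end StokesIdeal

/-! ### Solution of the scheme by a discrete stream function -/

section StreamFunction

variable {K : Type} [Field K]

/-- The general solution of the scheme in terms of a stream function, which takes the place of the
unknown `u`, and the pressure. The parameters `sx`, `sy`, `l` are the symbols of the two central
differences and of the discrete Laplacian. -/
def streamMatrix (Re : K) (sx sy l : PowerSeries (Symbol K)) :
    Matrix Unknown Unknown (PowerSeries (Symbol K)) :=
  Matrix.of fun
    | .u, .u => sy
    | .v, .u => -sx
    | .p, .p => 1
    | .f₁, .u => -(PowerSeries.C (single 0 (1 / Re)) * (l * sy))
    | .f₁, .p => sx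
    | .f₂, .u => PowerSeries.C (single 0 (1 / Re)) * (l * sx)
    | .f₂, .p => sy
    | _, _ => 0

variable (Re : K) {sx sy l : PowerSeries (Symbol K)}

/-- The pressure and the derivatives of a stream function as classes modulo the Stokes system. -/
def streamClass : Unknown × ℕ × ℕ → DiffPoly K ⧸ differentialIdeal (stokesSystem Re)
  | (.u, m, n + 1) => Ideal.Quotient.mk _ (MvPolynomial.X (.u, m, n))
  | (.u, m + 1, 0) => -Ideal.Quotient.mk _ (MvPolynomial.X (.v, m, 0))
  | (.p, m, n) => Ideal.Quotient.mk _ (MvPolynomial.X (.p, m, n))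
  -- ψ itself occurs in no field of the family, only its derivatives do; its value, like those for
  -- `v`, `f₁`, `f₂`, is arbitrary.
  | _ => 0

/-- A mixed derivative of ψ can be read through u or through v; the two readings agree by the
continuity equation. This is where incompressibility enters. -/
theorem streamClass_succ (m n : ℕ) : streamClass Re (.u, m + 1, n) =
    -Ideal.Quotient.mk _ (MvPolynomial.X (.v, m, n)) := by
  rcases n with _ | n
  · rfl
  · rw [eq_neg_iff_add_eq_zero]
    exact Ideal.Quotient.eq_zero_iff_mem.mpr (continuity_mem Re m n)

theorem constantCoeff_deform_X (N : Matrix Unknown Unknown (PowerSeries (Symbol K)))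
    (t : Unknown × ℕ × ℕ) : PowerSeries.constantCoeff (deform N (MvPolynomial.X t)) =
      ∑ w, applySymbol w (single t.2 1 * PowerSeries.constantCoeff (N t.1 w)) := by
  rw [deform_X, ← PowerSeries.coeff_zero_eq_constantCoeff_apply, coeff_applySeries]
  simp

/-- A differential polynomial which vanishes on all fields derived from a stream function and a
pressure belongs to the differential ideal of the Stokes system. -/
theorem mem_differentialIdeal_of_constantCoeff_deform
    (hsx : PowerSeries.constantCoeff sx = single (1, 0) 1)
    (hsy : PowerSeries.constantCoeff sy = single (0, 1) 1)
    (hl : PowerSeries.constantCoeff l = single (2, 0) 1 + single (0, 2) 1)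
    {f : DiffPoly K}
    (hf : PowerSeries.constantCoeff (deform (streamMatrix Re sx sy l) f) = 0) :
    f ∈ differentialIdeal (stokesSystem Re) := by
  let ρ : DiffPoly K →+* DiffPoly K ⧸ differentialIdeal (stokesSystem Re) :=
    MvPolynomial.eval₂Hom ((Ideal.Quotient.mk _).comp MvPolynomial.C) (streamClass Re)
  have hρC (a : K) : ρ (MvPolynomial.C a) = Ideal.Quotient.mk _ (MvPolynomial.C a) := by
    simp [ρ]
  have hρX (t : Unknown × ℕ × ℕ) : ρ (MvPolynomial.X t) = streamClass Re t := by
    simp [ρ]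
  -- ρ is a left inverse, modulo the Stokes ideal, of the limit substitution; agreement need only be
  -- checked on the derivatives of each unknown.
  suffices h : ρ.comp ((PowerSeries.constantCoeff (R := DiffPoly K)).comp
      (deform (streamMatrix Re sx sy l))) = Ideal.Quotient.mk _ by
    rw [← Ideal.Quotient.eq_zero_iff_mem, ← h, RingHom.comp_apply, RingHom.comp_apply, hf,
      map_zero]
  refine MvPolynomial.ringHom_ext ?_ ?_
  · intro a
    simp [deform_C, hρC]
  · rintro ⟨w, m, n⟩
    rw [RingHom.comp_apply, RingHom.comp_apply, constantCoeff_deform_X, sum_unknown]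
    cases w
    · simp [streamMatrix, hsy, applySymbol_single, hρX, AddMonoidAlgebra.single_mul_single]
      rfl
    · simp [streamMatrix, hsx, applySymbol_single, hρX, AddMonoidAlgebra.single_mul_single,
        streamClass_succ]
    · simp [streamMatrix, applySymbol_single, hρX]
      rfl
    · have h := Ideal.Quotient.eq_zero_iff_mem.mpr (momentum₁_mem Re m n)
      simp only [map_sub, map_mul, map_add] at h
      simp [streamMatrix, hsx, hsy, hl, applySymbol_single, hρX, hρC,
        AddMonoidAlgebra.single_mul_single, mul_add, add_mul]
      rw [show streamClass Re (.u, m + 2, n + 1) = Ideal.Quotient.mk _ (MvPolynomial.X (.u, m + 2, n))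
          from rfl, show streamClass Re (.u, m, n + 3) =
          Ideal.Quotient.mk _ (MvPolynomial.X (.u, m, n + 2)) from rfl,
        show streamClass Re (.p, m + 1, n) = Ideal.Quotient.mk _ (MvPolynomial.X (.p, m + 1, n))
          from rfl]
      rw [one_div] at h
      linear_combination h
    · have h := Ideal.Quotient.eq_zero_iff_mem.mpr (momentum₂_mem Re m n)
      simp only [map_sub, map_mul, map_add] at h
      simp [streamMatrix, hsx, hsy, hl, applySymbol_single, hρX, hρC,
        AddMonoidAlgebra.single_mul_single, mul_add, add_mul]
      rw [streamClass_succ, streamClass_succ, show streamClass Re (.p, m, n + 1) =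
        Ideal.Quotient.mk _ (MvPolynomial.X (.p, m, n + 1)) from rfl]
      rw [one_div] at h
      linear_combination h

end StreamFunction

/-! ### Difference symbols and the vanishing of the scheme on the stream-function family -/

section SchemeSolution

variable {K : Type} [Field K] [CharZero K]

theorem constantCoeff_translation (α β : K) :
    PowerSeries.constantCoeff (translation α β) = 1 := by
  rw [← PowerSeries.coeff_zero_eq_constantCoeff_apply, coeff_translation]
  simp [AddMonoidAlgebra.one_def, Prod.mk_zero_zero]

theorem coeff_one_translation (α β : K) :
    PowerSeries.coeff 1 (translation α β) = single (1, 0) α + single (0, 1) β := by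
  simp [coeff_translation, Finset.Nat.antidiagonal_succ, add_comm]

theorem coeff_two_translation (α β : K) : PowerSeries.coeff 2 (translation α β) =
    single (2, 0) (α ^ 2 / 2) + single (1, 1) (α * β) + single (0, 2) (β ^ 2 / 2) := by
  simp [coeff_translation, Finset.Nat.antidiagonal_succ]
  abel

/-- The terms of order 0 cancel, so the difference is divisible by h; the quotient is sinh(hD)/h
with D = α∂_x + β∂_y. -/
theorem exists_centralDifference (α β : K) : ∃ s : PowerSeries (Symbol K),
    2 * PowerSeries.X * s = translation α β - translation (-α) (-β) ∧
      PowerSeries.constantCoeff s = single (1, 0) α + single (0, 1) β := by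
  obtain ⟨s, hs⟩ := PowerSeries.X_dvd_iff.mpr
    (show PowerSeries.constantCoeff (translation α β - translation (-α) (-β)) = 0 by
      rw [map_sub, constantCoeff_translation, constantCoeff_translation, sub_self])
  have h := congrArg (PowerSeries.coeff 1) hs
  rw [map_sub, coeff_one_translation, coeff_one_translation, ← zero_add 1,
    PowerSeries.coeff_succ_X_mul, PowerSeries.coeff_zero_eq_constantCoeff_apply] at h
  refine ⟨(1 / 2 : K) • s, ?_, ?_⟩
  · rw [hs, mul_smul_comm, mul_assoc, two_mul, ← two_smul K, smul_smul]
    simp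
  · rw [← PowerSeries.coeff_zero_eq_constantCoeff_apply, PowerSeries.coeff_smul,
      PowerSeries.coeff_zero_eq_constantCoeff_apply, ← h, AddMonoidAlgebra.single_neg,
      AddMonoidAlgebra.single_neg]
    module

/-- Orders 0 and 1 cancel by the symmetry of the stencil; at order 2 each pair of opposite
translations contributes 1/2 + 1/2. -/
theorem exists_laplace : ∃ s : PowerSeries (Symbol K),
    PowerSeries.X ^ 2 * s = translation 1 0 + translation (-1) 0 + translation 0 1 +
      translation 0 (-1) - 4 ∧
      PowerSeries.constantCoeff s = single (2, 0) 1 + single (0, 2) 1 := by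
  have h4 : (4 : PowerSeries (Symbol K)) = PowerSeries.C 4 := (map_ofNat PowerSeries.C 4).symm
  obtain ⟨s, hs⟩ := (PowerSeries.X_pow_dvd_iff (n := 2)
    (φ := (translation 1 0 + translation (-1) 0 + translation 0 1 +
      translation 0 (-1) - 4 : PowerSeries (Symbol K)))).mpr (by
    intro m hm
    interval_cases m
    · rw [h4]
      simp only [map_add, map_sub, PowerSeries.coeff_zero_eq_constantCoeff_apply,
        constantCoeff_translation, PowerSeries.constantCoeff_C]
      norm_num
    · rw [h4]
      simp [coeff_one_translation])
  refine ⟨s, hs.symm, ?_⟩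
  have h := congrArg (PowerSeries.coeff 2) hs
  rw [PowerSeries.coeff_X_pow_mul', h4] at h
  simp only [map_add, map_sub, coeff_two_translation, PowerSeries.coeff_C] at h
  simp only [le_refl, if_true, Nat.sub_self,
    PowerSeries.coeff_zero_eq_constantCoeff_apply] at h
  rw [← h]
  have h2 (rs : ℕ × ℕ) : (single rs (1 : K) : Symbol K) =
      single rs (1 / 2) + single rs (1 / 2) := by
    rw [← AddMonoidAlgebra.single_add]
    norm_num
  rw [h2 (2, 0), h2 (0, 2)]
  norm_num
  abel

omit [CharZero K] in
theorem applySeries_C_smul (a : K) (q : Unknown → PowerSeries (Symbol K)) :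
    applySeries ((PowerSeries.C (single 0 a) : PowerSeries (Symbol K)) • q) =
      PowerSeries.C (MvPolynomial.C a) * applySeries q := by
  have h : (PowerSeries.C (single 0 a) : PowerSeries (Symbol K)) • q = a • q := by
    ext1 w
    ext1 n
    have ha : (single 0 a : Symbol K) = algebraMap K (Symbol K) a := by simp
    rw [Pi.smul_apply, smul_eq_mul, PowerSeries.coeff_C_mul, Pi.smul_apply,
      PowerSeries.coeff_smul, ha, ← Algebra.smul_def]
  rw [h, map_smul]
  ext1 n
  rw [PowerSeries.coeff_smul, PowerSeries.coeff_C_mul, MvPolynomial.smul_eq_C_mul]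

variable (Re : K) {sx sy l : PowerSeries (Symbol K)}

/-- Continuity holds because `sx` and `sy` commute, and the momentum equations because f₁, f₂ were
chosen to satisfy them. In the pressure equation the ψ terms of the discrete divergence of the
forces cancel, leaving (sx² + sy²)p. -/
theorem scheme_subset_ker_deformedTaylor
    (hsx : 2 * PowerSeries.X * sx = translation 1 0 - translation (-1) 0)
    (hsy : 2 * PowerSeries.X * sy = translation 0 1 - translation 0 (-1))
    (hl : PowerSeries.X ^ 2 * l = translation 1 0 + translation (-1) 0 + translation 0 1 +
      translation 0 (-1) - 4) :
    scheme Re ⊆ (RingHom.ker (deformedTaylor (streamMatrix Re sx sy l) 0) : Set (GridPoly K)) := by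
  set N := streamMatrix Re sx sy l with hN
  set E : ℕ → ℕ → PowerSeries (Symbol K) := fun a b => translation (a : K) b with hE
  have hEmul (a b a' b' : ℕ) : E a b * E a' b' = E (a + a') (b + b') := by
    simp only [hE, translation_mul, Nat.cast_add]
  have hx : E 1 1 * (2 * PowerSeries.X * sx) = E 2 1 - E 0 1 := by
    rw [hsx, mul_sub]
    simp only [hE, translation_mul]
    norm_num
  have hy : E 1 1 * (2 * PowerSeries.X * sy) = E 1 2 - E 1 0 := by
    rw [hsy, mul_sub]
    simp only [hE, translation_mul]
    norm_num
  have hlap : E 1 1 * (PowerSeries.X ^ 2 * l) =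
      E 2 1 + E 1 2 - 4 * E 1 1 + E 1 0 + E 0 1 := by
    rw [hl, mul_sub, mul_add, mul_add, mul_add]
    simp only [hE, translation_mul]
    norm_num
    ring
  let ofPS := HahnSeries.ofPowerSeries ℤ (DiffPoly K)
  let P : (Unknown → PowerSeries (Symbol K)) →+ LaurentSeries (DiffPoly K) :=
    ofPS.toAddMonoidHom.comp applySeries.toAddMonoidHom
  set H : LaurentSeries (DiffPoly K) := coeffExpansion spacing with hH
  set r : LaurentSeries (DiffPoly K) := coeffExpansion (1 / RatFunc.C Re) with hr
  have hPX (q : Unknown → PowerSeries (Symbol K)) :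
      P ((PowerSeries.X : PowerSeries (Symbol K)) • q) = H * P q := by
    rw [hH, spacing, coeffExpansion_X]
    exact (congrArg ofPS (applySeries_X_smul q)).trans (map_mul ofPS _ _)
  have hPC (q : Unknown → PowerSeries (Symbol K)) :
      P ((PowerSeries.C (single 0 (1 / Re)) : PowerSeries (Symbol K)) • q) = r * P q := by
    rw [hr, ← map_one RatFunc.C, ← map_div₀, coeffExpansion_C]
    exact (congrArg ofPS (applySeries_C_smul _ q)).trans (map_mul ofPS _ _)
  have hgrid (w : Unknown) (a b : ℕ) : deformedTaylor N 0 (grid w a b) = P (E a b • N.row w) := by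
    rw [grid, deformedTaylor_X]
    simp [hE, P, ofPS]
  have hspacing : (spacing : RatFunc K) ≠ 0 := RatFunc.X_ne_zero
  have : CharZero (RatFunc K) := charZero_of_injective_algebraMap (algebraMap K _).injective
  have hH0 : H ≠ 0 := (map_ne_zero _).mpr hspacing
  have h₁ : 2 * H * coeffExpansion (1 / (2 * spacing)) = 1 := by
    rw [hH, ← map_ofNat coeffExpansion 2, ← map_mul, ← map_mul, mul_one_div_cancel, map_one]
    exact mul_ne_zero two_ne_zero hspacing
  have h₂ : H ^ 2 * coeffExpansion (1 / spacing ^ 2) = 1 := by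
    rw [hH, ← map_pow, ← map_mul, mul_one_div_cancel, map_one]
    exact pow_ne_zero 2 hspacing
  have h₃ : 4 * H ^ 2 * coeffExpansion (1 / (4 * spacing ^ 2)) = 1 := by
    rw [hH, ← map_ofNat coeffExpansion 4, ← map_pow, ← map_mul, ← map_mul, mul_one_div_cancel,
      map_one]
    exact mul_ne_zero (OfNat.ofNat_ne_zero 4) (pow_ne_zero 2 hspacing)
  set κ : PowerSeries (Symbol K) := PowerSeries.C (single 0 (1 / Re)) with hκ
  -- The same central differences, recentred from (1, 1) to (2, 2), the centre of the 5 × 5 stencil.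
  have hx' : E 2 2 * (2 * PowerSeries.X * sx) = E 3 2 - E 1 2 := by
    linear_combination E 1 1 * hx - (2 * PowerSeries.X * sx) * hEmul 1 1 1 1 +
      hEmul 1 1 2 1 - hEmul 1 1 0 1
  have hy' : E 2 2 * (2 * PowerSeries.X * sy) = E 2 3 - E 2 1 := by
    linear_combination E 1 1 * hy - (2 * PowerSeries.X * sy) * hEmul 1 1 1 1 +
      hEmul 1 1 1 2 - hEmul 1 1 1 0
  -- Squaring a central difference doubles its step: this is the stencil of Δ₂, with 4h² cleared.
  have hlap' : E 2 2 * ((2 * PowerSeries.X * sx) ^ 2 + (2 * PowerSeries.X * sy) ^ 2) =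
      E 4 2 + E 2 4 - 4 * E 2 2 + E 2 0 + E 0 2 := by
    have h22 := hEmul 1 1 1 1
    have hx2 := congrArg (· ^ 2) hx
    have hy2 := congrArg (· ^ 2) hy
    linear_combination hx2 + hy2 -
      ((2 * PowerSeries.X * sx) ^ 2 + (2 * PowerSeries.X * sy) ^ 2) * h22 +
      hEmul 2 1 2 1 - 2 * hEmul 2 1 0 1 + hEmul 0 1 0 1 +
      hEmul 1 2 1 2 - 2 * hEmul 1 2 1 0 + hEmul 1 0 1 0
  -- The four equations with denominators cleared by 2h, 2h², 2h² and 4h² respectively, as row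
  -- identities in the symbols; the only nontrivial columns are `u` (the stream function) and `p`.
  have key₁ : (E 2 1 • N.row .u - E 0 1 • N.row .u) +
      (E 1 2 • N.row .v - E 1 0 • N.row .v) = 0 := by
    ext1 w
    cases w <;> simp [hN, streamMatrix, -one_div, ← hκ]
    linear_combination (-sy) * hx + sx * hy
  have key₂ : (PowerSeries.X : PowerSeries (Symbol K)) • (E 2 1 • N.row .p - E 0 1 • N.row .p) -
      κ • (2 : ℕ) • (E 2 1 • N.row .u + E 1 2 • N.row .u - (4 : ℕ) • E 1 1 • N.row .u +
        E 1 0 • N.row .u + E 0 1 • N.row .u) -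
      (PowerSeries.X : PowerSeries (Symbol K)) • (PowerSeries.X : PowerSeries (Symbol K)) •
        (2 : ℕ) • E 1 1 • N.row .f₁ = 0 := by
    ext1 w
    cases w <;> simp [hN, streamMatrix, -one_div, ← hκ]
    · linear_combination (2 * κ * sy) * hlap
    · linear_combination (-PowerSeries.X) * hx
  have key₃ : (PowerSeries.X : PowerSeries (Symbol K)) • (E 1 2 • N.row .p - E 1 0 • N.row .p) -
      κ • (2 : ℕ) • (E 2 1 • N.row .v + E 1 2 • N.row .v - (4 : ℕ) • E 1 1 • N.row .v +
        E 1 0 • N.row .v + E 0 1 • N.row .v) -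
      (PowerSeries.X : PowerSeries (Symbol K)) • (PowerSeries.X : PowerSeries (Symbol K)) •
        (2 : ℕ) • E 1 1 • N.row .f₂ = 0 := by
    ext1 w
    cases w <;> simp [hN, streamMatrix, -one_div, ← hκ]
    · linear_combination (-2 * κ * sx) * hlap
    · linear_combination (-PowerSeries.X) * hy
  have key₄ : (E 4 2 • N.row .p + E 2 4 • N.row .p - (4 : ℕ) • E 2 2 • N.row .p +
        E 2 0 • N.row .p + E 0 2 • N.row .p) -
      (PowerSeries.X : PowerSeries (Symbol K)) • (2 : ℕ) •
        (E 3 2 • N.row .f₁ - E 1 2 • N.row .f₁) -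
      (PowerSeries.X : PowerSeries (Symbol K)) • (2 : ℕ) •
        (E 2 3 • N.row .f₂ - E 2 1 • N.row .f₂) = 0 := by
    ext1 w
    cases w <;> simp [hN, streamMatrix, -one_div, ← hκ]
    · linear_combination (-2 * PowerSeries.X * κ * l * sy) * hx' +
        (2 * PowerSeries.X * κ * l * sx) * hy'
    · linear_combination -hlap' + (2 * PowerSeries.X * sx) * hx' + (2 * PowerSeries.X * sy) * hy'
  replace key₁ := congrArg P key₁
  replace key₂ := congrArg P key₂
  replace key₃ := congrArg P key₃
  replace key₄ := congrArg P key₄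
  simp only [map_add, map_sub, map_zero, hPX, hPC, map_nsmul] at key₁ key₂ key₃ key₄
  simp only [nsmul_eq_mul, Nat.cast_ofNat] at key₂ key₃ key₄
  intro g hg
  rw [SetLike.mem_coe, RingHom.mem_ker]
  rcases hg with rfl | rfl | rfl | rfl
  · simp only [scheme₁, map_add, map_sub, map_mul, hgrid, deformedTaylor_C]
    linear_combination coeffExpansion (1 / (2 * spacing)) * key₁
  -- The nonzero factor 2h² is restored so that the cleared identity applies.
  · refine (mul_eq_zero.mp ?_).resolve_left
      (mul_ne_zero (left_ne_zero_of_mul_eq_one h₁) hH0)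
    simp only [scheme₂, laplace₁, map_add, map_sub, map_mul, map_ofNat, hgrid, deformedTaylor_C,
      ← hr]
    linear_combination key₂ + H * (P (E 2 1 • N.row .p) - P (E 0 1 • N.row .p)) * h₁ -
      2 * r * (P (E 2 1 • N.row .u) + P (E 1 2 • N.row .u) - 4 * P (E 1 1 • N.row .u) +
        P (E 1 0 • N.row .u) + P (E 0 1 • N.row .u)) * h₂
  · refine (mul_eq_zero.mp ?_).resolve_left
      (mul_ne_zero (left_ne_zero_of_mul_eq_one h₁) hH0)
    simp only [scheme₃, laplace₁, map_add, map_sub, map_mul, map_ofNat, hgrid, deformedTaylor_C,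
      ← hr]
    linear_combination key₃ + H * (P (E 1 2 • N.row .p) - P (E 1 0 • N.row .p)) * h₁ -
      2 * r * (P (E 2 1 • N.row .v) + P (E 1 2 • N.row .v) - 4 * P (E 1 1 • N.row .v) +
        P (E 1 0 • N.row .v) + P (E 0 1 • N.row .v)) * h₂
  · refine (mul_eq_zero.mp ?_).resolve_left (left_ne_zero_of_mul_eq_one h₃)
    simp only [scheme₄, laplace₂, map_add, map_sub, map_mul, map_ofNat, hgrid, deformedTaylor_C]
    linear_combination key₄ - 2 * H * (P (E 3 2 • N.row .f₁) - P (E 1 2 • N.row .f₁) +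
        P (E 2 3 • N.row .f₂) - P (E 2 1 • N.row .f₂)) * h₁ +
      (P (E 4 2 • N.row .p) + P (E 2 4 • N.row .p) - 4 * P (E 2 2 • N.row .p) +
        P (E 2 0 • N.row .p) + P (E 0 2 • N.row .p)) * h₃

end SchemeSolution

/-- The symmetric scheme is strongly consistent with the Stokes system, over any field of
characteristic zero. -/
theorem isStronglyConsistent_scheme {K : Type} [Field K] [CharZero K] (Re : K) :
    IsStronglyConsistent (scheme Re) (stokesSystem Re) := by
  intro g hg
  obtain ⟨sx, hsx, hsx₀⟩ := exists_centralDifference (1 : K) 0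
  obtain ⟨sy, hsy, hsy₀⟩ := exists_centralDifference (0 : K) 1
  obtain ⟨l, hl, hl₀⟩ := exists_laplace (K := K)
  simp only [neg_zero, AddMonoidAlgebra.single_zero, add_zero, zero_add] at hsx hsy hsx₀ hsy₀
  have hker : g ∈ RingHom.ker (deformedTaylor (streamMatrix Re sx sy l) 0) := by
    rw [perfectDifferenceIdeal, Submodule.mem_sInf] at hg
    exact hg _ ⟨isPerfectDifferenceIdeal_ker_deformedTaylor _,
      scheme_subset_ker_deformedTaylor Re hsx hsy hl⟩
  exact ⟨_, mem_differentialIdeal_of_constantCoeff_deform Re hsx₀ hsy₀ hl₀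
    (constantCoeff_deform_leadingCoeff _ hker), implies_leadingCoeff g⟩

end

end StokesFD

theorem mainTheorem1 :
    StokesFD.IsStronglyConsistent
      (StokesFD.scheme (RatFunc.X : RatFunc ℚ))
      (StokesFD.stokesSystem (RatFunc.X : RatFunc ℚ)) :=
  haveI : CharZero (RatFunc ℚ) := charZero_of_injective_algebraMap (algebraMap ℚ _).injective
  StokesFD.isStronglyConsistent_scheme _
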